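/- For a finite simple graph $G$ and reals $B,\lambda$ let $$Z_G(B,\lambda)=\sum_{\sigma:V(G)\to\{+,-\}}B^{m_G(\sigma)}\lambda^{n_G(+,\sigma)},$$ where $m_G(\sigma)$ is the number of edges of $G$ whose endpoints get the same spin and $n_G(+,\sigma)$ is the number of vertices with spin $+$, and for $G$ with at least one vertex let the occupancy fraction be $$\alpha_G(B,\lambda)=\frac{\lambda}{|V(G)|}\,\frac{\partial}{\partial\lambda}\log Z_G(B,\lambda).$$ For $0\le B\le\frac13$ put $B_c=\frac13$, $r=\frac{B_c-B}{B_c+B}$, $s=\frac{1-B}{1+B}$, and let $$\lambda_c(3,B)=\frac{1-\sqrt{r/s}}{1+\sqrt{r/s}}\left(\frac{1+\sqrt{rs}}{1-\sqrt{rs}}\right)^{\frac{B_c+1}{B_c-1}}\quad(B>0),\qquad \lambda_c(3,0)=0;$$ for $0<B<\frac13$ this is the uniqueness threshold of the antiferromagnetic Ising model on the infinite $3$-regular tree. Set $\alpha_c(3,B)=\inf_G\alpha_G(B,\lambda_c(3,B))$, the infimum over all finite nonempty $3$-regular simple graphs. **Theorem.** For every $B$ with $0\le B\le 0.3128$, the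 complete graph $K_4$ minimizes the occupancy fraction at $\lambda=\lambda_c(3,B)$ over $3$-regular graphs: $K_4$ is $3$-regular, and $$\alpha_{K_4}(B,\lambda_c(3,B))\le\alpha_G(B,\lambda_c(3,B))$$ for every finite nonempty $3$-regular simple graph $G$. Consequently $\alpha_c(3,B)=\alpha_{K_4}(B,\lambda_c(3,B))$. (In the degenerate case $B=0$, where $\lambda_c(3,0)=0$ and $Z_{K_4}(0,\lambda)=0$, the occupancy fraction is taken to be $0$ because of its factor $\lambda=0$, and the assertion is trivial; the content is the range $0<B\le 0.3128$.) -/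

import Mathlib

open Finset

noncomputable section

/-- The number of monochromatic edges of `G` under the spin assignment `σ`
(`true` is the spin `+`, `false` the spin `-`): the edges whose two endpoints get the same spin. -/
def monoEdges {V : Type*} (G : SimpleGraph V) (σ : V → Bool) : ℕ :=
  {e ∈ G.edgeSet | (e.map σ).IsDiag}.ncard

/-- The number of vertices with spin `+`. -/
def numPlus {V : Type*} [Fintype V] (σ : V → Bool) : ℕ :=
  #{v | σ v = true}

open Classical in
/-- The Ising partition function with edge activity `B` and external field `l`. -/
def isingZ {V : Type*} [Fintype V] (G : SimpleGraph V) (B l : ℝ) : ℝ :=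
  ∑ σ : V → Bool, B ^ monoEdges G σ * l ^ numPlus σ

/-- The occupancy fraction: `l / |V|` times the derivative in the external field of the logarithm of
the partition function. -/
def occupancyFraction {V : Type*} [Fintype V] (G : SimpleGraph V) (B l : ℝ) : ℝ :=
  l / (Fintype.card V : ℝ) * deriv (fun t : ℝ => Real.log (isingZ G B t)) l

/-- The critical edge activity `(Δ - 2) / Δ`. -/
def criticalB (Δ : ℕ) : ℝ := ((Δ : ℝ) - 2) / (Δ : ℝ)

/-- The critical external field for uniqueness of the antiferromagnetic Ising measure on the
infinite `Δ`-regular tree, for `0 < B < criticalB Δ`. The exponent equals `-(Δ - 1)`.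

With `x = (1 - √(r/s)) / (1 + √(r/s))` and `y = (1 - √(rs)) / (1 + √(rs))` one has
`y = (x + B) / (B x + 1)`, so `l = x y ^ (Δ - 1)` is the field for which `x` is the fixed point of
the tree recursion `R ↦ l ((B R + 1) / (R + B)) ^ (Δ - 1)`; the value of `x` is the one at which
the derivative of this recursion is `-1`. -/
def lambdaC (Δ : ℕ) (B : ℝ) : ℝ :=
  let r := (criticalB Δ - B) / (criticalB Δ + B)
  let s := (1 - B) / (1 + B)
  (1 - √(r / s)) / (1 + √(r / s)) *
    ((1 + √(r * s)) / (1 - √(r * s))) ^ ((criticalB Δ + 1) / (criticalB Δ - 1))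

open Classical in
/-- The infimum of the occupancy fraction over all (finite, nonempty) `Δ`-regular graphs.
Every finite graph is isomorphic to one on some `Fin n`. -/
def alphaInf (Δ : ℕ) (B l : ℝ) : ℝ :=
  sInf {a : ℝ | ∃ (n : ℕ) (G : SimpleGraph (Fin n)),
    0 < n ∧ G.IsRegularOfDegree Δ ∧ a = occupancyFraction G B l}

/-- The threshold density `α_c`, as a function of `Δ` and `B`. -/
def alphaC (Δ : ℕ) (B : ℝ) : ℝ := alphaInf Δ B (lambdaC Δ B)

end

/-! The proof is a linear programming duality certificate for the Gibbs measure. For any function f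
of the number of plus neighbours, let the observable at v be σ(v) − a + f at v minus the mean of f
over the three neighbours of v. In a cubic graph the f terms cancel on summing over v, so the total
expectation is |V| (α_G − a) (`sum_observable`, `occupancyFraction_sub_mul`). Given the spins
outside v and its neighbours, the conditional expectation of the observable is a positive multiple
of a `localSum`, which depends only on the edges among the neighbours and on their numbers of outer
plus neighbours. Hence a ≤ α_G once these finitely many sums are nonnegative.

Take a = α_{K₄}. The triangle configuration gives exactly 0 for every f, by the symmetry of K₄. For
the others f is the explicit `mult`. The critical curve is rational in one parameter u, so, with
α_{K₄} replaced by the polynomial upper bound `occBound`, each case is a polynomial inequality on 0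
≤ u < 0.933. -/

/-! ### Local sums and their symmetries. -/

/-- The sum over the spins `s₀` of a vertex and `s₁, s₂, s₃` of its three neighbours of the relative
weight of these spins times `s₀ - a` plus the discrepancy of `f` between the vertex and its
neighbours. Here `eᵢⱼ` counts the edges between the `i`-th and the `j`-th neighbour, and `kᵢ` the
plus spins among the other neighbours of the `i`-th one. -/
noncomputable def localSum (a : ℝ) (f : ℕ → ℝ) (L b : ℝ) (e₁₂ e₁₃ e₂₃ k₁ k₂ k₃ : ℕ) : ℝ :=
  ∑ s₀ ∈ range 2, ∑ s₁ ∈ range 2, ∑ s₂ ∈ range 2, ∑ s₃ ∈ range 2,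
    L ^ (s₀ + s₁ + s₂ + s₃) *
      b ^ (s₀ * (s₁ + s₂ + s₃) + e₁₂ * s₁ * s₂ + e₁₃ * s₁ * s₃ + e₂₃ * s₂ * s₃ +
        k₁ * s₁ + k₂ * s₂ + k₃ * s₃) *
      (s₀ - a + f (s₁ + s₂ + s₃) -
        (f (k₁ + s₀ + e₁₂ * s₂ + e₁₃ * s₃) + f (k₂ + s₀ + e₁₂ * s₁ + e₂₃ * s₃) +
          f (k₃ + s₀ + e₁₃ * s₁ + e₂₃ * s₂)) / 3)

theorem localSum_swap₁₂ (a : ℝ) (f : ℕ → ℝ) (L b : ℝ) (e₁₂ e₁₃ e₂₃ k₁ k₂ k₃ : ℕ) :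
    localSum a f L b e₁₂ e₂₃ e₁₃ k₂ k₁ k₃ = localSum a f L b e₁₂ e₁₃ e₂₃ k₁ k₂ k₃ := by
  unfold localSum
  refine sum_congr rfl fun s₀ _ => ?_
  rw [sum_comm]
  refine sum_congr rfl fun s₁ _ => sum_congr rfl fun s₂ _ => sum_congr rfl fun s₃ _ => ?_
  ring_nf

theorem localSum_swap₂₃ (a : ℝ) (f : ℕ → ℝ) (L b : ℝ) (e₁₂ e₁₃ e₂₃ k₁ k₂ k₃ : ℕ) :
    localSum a f L b e₁₃ e₁₂ e₂₃ k₁ k₃ k₂ = localSum a f L b e₁₂ e₁₃ e₂₃ k₁ k₂ k₃ := by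
  unfold localSum
  refine sum_congr rfl fun s₀ _ => sum_congr rfl fun s₁ _ => ?_
  rw [sum_comm]
  refine sum_congr rfl fun s₂ _ => sum_congr rfl fun s₃ _ => ?_
  ring_nf

/-- The number a enters only as −a times nonnegative weights, so an upper bound for the occupancy of
K₄ may replace it. -/
theorem localSum_anti {a a' : ℝ} (h : a ≤ a') (f : ℕ → ℝ) {L b : ℝ} (hL : 0 ≤ L) (hb : 0 ≤ b)
    (e₁₂ e₁₃ e₂₃ k₁ k₂ k₃ : ℕ) :
    localSum a' f L b e₁₂ e₁₃ e₂₃ k₁ k₂ k₃ ≤ localSum a f L b e₁₂ e₁₃ e₂₃ k₁ k₂ k₃ := by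
  unfold localSum
  gcongr

/-- The occupancy fraction of `K₄` in terms of the activities `L` and `b`. -/
noncomputable def occK4 (L b : ℝ) : ℝ :=
  (L + 3 * L ^ 2 * b + 3 * L ^ 3 * b ^ 3 + L ^ 4 * b ^ 6) /
    (1 + 4 * L + 6 * L ^ 2 * b + 4 * L ^ 3 * b ^ 3 + L ^ 4 * b ^ 6)

/-- Here the vertex and its neighbours form a K₄. The weight is symmetric in the four vertices, so
the f terms cancel; what remains is the numerator of `occK4` minus a times its denominator. -/
theorem localSum_triangle (f : ℕ → ℝ) {L b : ℝ} (hL : 0 ≤ L) (hb : 0 ≤ b) :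
    localSum (occK4 L b) f L b 1 1 1 0 0 0 = 0 := by
  have h : 0 < 1 + 4 * L + 6 * L ^ 2 * b + 4 * L ^ 3 * b ^ 3 + L ^ 4 * b ^ 6 := by positivity
  have key : occK4 L b * (1 + 4 * L + 6 * L ^ 2 * b + 4 * L ^ 3 * b ^ 3 + L ^ 4 * b ^ 6) =
      L + 3 * L ^ 2 * b + 3 * L ^ 3 * b ^ 3 + L ^ 4 * b ^ 6 := div_mul_cancel₀ _ h.ne'
  simp only [localSum, sum_range_succ, sum_range_zero]
  norm_num
  linear_combination -key

/-! ### The certificate on the critical curve. -/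

/-- The multipliers of the local inequality on the critical curve. -/
noncomputable def mult (u : ℝ) : ℕ → ℝ
  | 1 => 0.46 - 0.24 * u
  | 2 => 0.48 - 0.032 * u
  | 3 => 0.46 + 0.038 * u
  -- Only arguments up to 3 occur. The value at 0 is a normalization: adding a constant to f changes
  -- no discrepancy.
  | _ => 0

/-- A polynomial upper bound for the occupancy fraction of `K₄` on the critical curve. -/
noncomputable def occBound (u : ℝ) : ℝ := 0.2387 + 0.3613 * u - 0.261 * u ^ 2 + 0.0889 * u ^ 3

/-- The activity `λ / B ^ 3` on the critical curve. -/
noncomputable def critL (u : ℝ) : ℝ := (u + 1) * (u + 4) ^ 2 / 4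

/-- The activity `B ^ 2` on the critical curve. -/
noncomputable def critb (u : ℝ) : ℝ := u / ((u + 1) * (u + 4))

theorem critL_nonneg {u : ℝ} (hu : 0 ≤ u) : 0 ≤ critL u := by unfold critL; positivity

theorem critb_nonneg {u : ℝ} (hu : 0 ≤ u) : 0 ≤ critb u := by unfold critb; positivity

/-- This maps [0, U) onto t ≥ 0. A polynomial inequality in u then follows, after clearing
denominators, if all coefficients in t are nonnegative, which `positivity` checks. -/
theorem exists_eq_mul_div_one_add {U u : ℝ} (hu : 0 ≤ u) (hU : u < U) :
    ∃ t, 0 ≤ t ∧ u = U * t / (1 + t) := by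
  have h : 0 < U - u := sub_pos.2 hU
  have hU0 : 0 < U := hu.trans_lt hU
  refine ⟨u / (U - u), by positivity, ?_⟩
  have h' : 1 + u / (U - u) = U / (U - u) := by field_simp; ring
  rw [h']
  field_simp

theorem occK4_le_occBound {u : ℝ} (hu : 0 ≤ u) (hU : u < 0.933) :
    occK4 (critL u) (critb u) ≤ occBound u := by
  have hL := critL_nonneg hu
  have hb := critb_nonneg hu
  unfold occK4
  rw [div_le_iff₀ (by positivity), ← sub_nonneg]
  obtain ⟨t, ht, rfl⟩ := exists_eq_mul_div_one_add hu hU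
  simp only [occBound, critL, critb]
  field_simp
  ring_nf
  positivity

set_option maxHeartbeats 4000000 in
theorem localSum_nonneg_of_no_edge {u : ℝ} (hu : 0 ≤ u) (hU : u < 0.933) {k₁ k₂ k₃ : ℕ}
    (h₁₂ : k₁ ≤ k₂) (h₂₃ : k₂ ≤ k₃) (h₃ : k₃ ≤ 2) :
    0 ≤ localSum (occBound u) (mult u) (critL u) (critb u) 0 0 0 k₁ k₂ k₃ := by
  obtain ⟨t, ht, rfl⟩ := exists_eq_mul_div_one_add hu hU
  interval_cases k₃ <;> interval_cases k₂ <;> interval_cases k₁ <;>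
  · simp [localSum, sum_range_succ, mult, occBound, critL, critb]
    field_simp
    ring_nf
    positivity

set_option maxHeartbeats 4000000 in
theorem localSum_nonneg_of_one_edge {u : ℝ} (hu : 0 ≤ u) (hU : u < 0.933) {k₁ k₂ k₃ : ℕ}
    (h₁₂ : k₁ ≤ k₂) (h₂ : k₂ ≤ 1) (h₃ : k₃ ≤ 2) :
    0 ≤ localSum (occBound u) (mult u) (critL u) (critb u) 1 0 0 k₁ k₂ k₃ := by
  obtain ⟨t, ht, rfl⟩ := exists_eq_mul_div_one_add hu hU
  interval_cases k₃ <;> interval_cases k₂ <;> interval_cases k₁ <;>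
  · simp [localSum, sum_range_succ, mult, occBound, critL, critb]
    field_simp
    ring_nf
    positivity

set_option maxHeartbeats 4000000 in
theorem localSum_nonneg_of_path {u : ℝ} (hu : 0 ≤ u) (hU : u < 0.933) {k₁ k₃ : ℕ}
    (h₁₃ : k₁ ≤ k₃) (h₃ : k₃ ≤ 1) :
    0 ≤ localSum (occBound u) (mult u) (critL u) (critb u) 1 0 1 k₁ 0 k₃ := by
  obtain ⟨t, ht, rfl⟩ := exists_eq_mul_div_one_add hu hU
  interval_cases k₃ <;> interval_cases k₁ <;>
  · simp [localSum, sum_range_succ, mult, occBound, critL, critb]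
    field_simp
    ring_nf
    positivity

theorem localSum_nonneg {u : ℝ} (hu : 0 ≤ u) (hU : u < 0.933) {e₁₂ e₁₃ e₂₃ k₁ k₂ k₃ : ℕ}
    (h₁₂ : e₁₂ ≤ 1) (h₁₃ : e₁₃ ≤ 1) (h₂₃ : e₂₃ ≤ 1)
    (h₁ : k₁ + e₁₂ + e₁₃ ≤ 2) (h₂ : k₂ + e₁₂ + e₂₃ ≤ 2) (h₃ : k₃ + e₁₃ + e₂₃ ≤ 2) :
    0 ≤ localSum (occK4 (critL u) (critb u)) (mult u) (critL u) (critb u)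
      e₁₂ e₁₃ e₂₃ k₁ k₂ k₃ := by
  have hL := critL_nonneg hu
  have hb := critb_nonneg hu
  by_cases hK : e₁₂ = 1 ∧ e₁₃ = 1 ∧ e₂₃ = 1
  · obtain ⟨rfl, rfl, rfl⟩ := hK
    obtain ⟨rfl, rfl, rfl⟩ : k₁ = 0 ∧ k₂ = 0 ∧ k₃ = 0 := by lia
    exact (localSum_triangle _ hL hb).ge
  -- Only the triangle needs the exact value of the occupancy; elsewhere there is room for the
  -- polynomial bound. The swaps below reduce the remaining cases to sorted representatives with no
  -- edge, one edge, or a path among the neighbours.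
  refine le_trans ?_ (localSum_anti (occK4_le_occBound hu hU) _ hL hb ..)
  have one {k₁ k₂ k₃ : ℕ} (h₁ : k₁ ≤ 1) (h₂ : k₂ ≤ 1) (h₃ : k₃ ≤ 2) :
      0 ≤ localSum (occBound u) (mult u) (critL u) (critb u) 1 0 0 k₁ k₂ k₃ := by
    rcases le_total k₁ k₂ with h | h
    · exact localSum_nonneg_of_one_edge hu hU h h₂ h₃
    · rw [← localSum_swap₁₂]
      exact localSum_nonneg_of_one_edge hu hU h h₁ h₃
  have path {k₁ k₃ : ℕ} (h₁ : k₁ ≤ 1) (h₃ : k₃ ≤ 1) :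
      0 ≤ localSum (occBound u) (mult u) (critL u) (critb u) 1 0 1 k₁ 0 k₃ := by
    rcases le_total k₁ k₃ with h | h
    · exact localSum_nonneg_of_path hu hU h h₃
    · rw [← localSum_swap₁₂, ← localSum_swap₂₃, ← localSum_swap₁₂]
      exact localSum_nonneg_of_path hu hU h h₁
  have two {k₁ k₂ k₃ : ℕ} (h : k₁ ≤ k₂) (h₂ : k₂ ≤ 2) (h₃ : k₃ ≤ 2) :
      0 ≤ localSum (occBound u) (mult u) (critL u) (critb u) 0 0 0 k₁ k₂ k₃ := by
    rcases le_total k₂ k₃ with h' | h'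
    · exact localSum_nonneg_of_no_edge hu hU h h' h₃
    · rw [← localSum_swap₂₃]
      rcases le_total k₁ k₃ with h'' | h''
      · exact localSum_nonneg_of_no_edge hu hU h'' h' h₂
      · rw [← localSum_swap₁₂]
        exact localSum_nonneg_of_no_edge hu hU h'' h h₂
  interval_cases e₁₂ <;> interval_cases e₁₃ <;> interval_cases e₂₃
  · rcases le_total k₁ k₂ with h | h
    · exact two h h₂ h₃
    · rw [← localSum_swap₁₂]
      exact two h h₁ h₃
  · rw [← localSum_swap₁₂, ← localSum_swap₂₃]
    exact one (by lia) (by lia) (by lia)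
  · rw [← localSum_swap₂₃]
    exact one (by lia) (by lia) (by lia)
  · obtain rfl : k₃ = 0 := by lia
    rw [← localSum_swap₂₃]
    exact path (by lia) (by lia)
  · exact one (by lia) (by lia) (by lia)
  · obtain rfl : k₂ = 0 := by lia
    exact path (by lia) (by lia)
  · obtain rfl : k₁ = 0 := by lia
    rw [← localSum_swap₁₂]
    exact path (by lia) (by lia)
  · simp at hK

/-! ### Rational parametrization of the critical field. -/

/-- For small `B`, the critical field lies on the rational curve `L = critL u`, `b = critb u`. -/
theorem exists_critical_parameter {B : ℝ} (hB : 0 < B) (hB1 : B ≤ 0.3128) :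
    0 < lambdaC 3 B ∧ ∃ u, 0 ≤ u ∧ u < 0.933 ∧ lambdaC 3 B / B ^ 3 = critL u ∧ B ^ 2 = critb u := by
  -- The witness is p = √(r/s); since √(rs) = p s, a single square root is involved.
  obtain ⟨p, hp0, hp1, hp2, hpl⟩ : ∃ p : ℝ, 0 ≤ p ∧ p < 1 ∧
      p ^ 2 * ((1 + 3 * B) * (1 - B)) = (1 - 3 * B) * (1 + B) ∧
      lambdaC 3 B = (1 - p) / (1 + p) *
        ((1 + B + p * (1 - B)) / (1 + B - p * (1 - B))) ^ (-2 : ℝ) := by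
    have hc : criticalB 3 = 1 / 3 := by norm_num [criticalB]
    have h1 : 0 < 1 - B := by linarith
    have h3 : 0 < 1 - 3 * B := by linarith
    set r : ℝ := (1 / 3 - B) / (1 / 3 + B) with hr
    set s : ℝ := (1 - B) / (1 + B) with hs
    have hs0 : 0 < s := by positivity
    have hr' : r = (1 - 3 * B) / (1 + 3 * B) := by rw [hr]; field_simp
    have hr0 : 0 < r := by rw [hr']; positivity
    have hsq : √(r / s) ^ 2 = r / s := Real.sq_sqrt (by positivity)
    refine ⟨√(r / s), Real.sqrt_nonneg _, ?_, ?_, ?_⟩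
    · rw [Real.sqrt_lt' one_pos, one_pow, div_lt_one hs0, hr', hs,
        div_lt_div_iff₀ (by positivity) (by positivity)]
      nlinarith
    · rw [hsq, hr', hs]; field_simp
    · have hq : √(r * s) = √(r / s) * s := by
        rw [← Real.sqrt_sq hs0.le, ← Real.sqrt_mul (by positivity), Real.sqrt_sq hs0.le]
        congr 1
        field_simp
      have he : ((1 / 3 : ℝ) + 1) / (1 / 3 - 1) = -2 := by norm_num
      simp only [lambdaC, hc, ← hr, ← hs, he]
      rw [hq]
      congr 2
      rw [hs]
      field_simp
  have hpB : 0 < 1 + B - p * (1 - B) := by nlinarith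
  have hlam : lambdaC 3 B = (1 - p) / (1 + p) *
      ((1 + B - p * (1 - B)) / (1 + B + p * (1 - B))) ^ 2 := by
    rw [hpl, Real.rpow_neg (div_nonneg (by nlinarith) hpB.le), Real.rpow_two, ← inv_pow, inv_div]
  have hpB' : 0 < 1 + B + p * (1 - B) := by nlinarith
  have hp : 0 < 1 - p := by linarith
  -- This is the tree fixed point x divided by B; the quadratic relation for p becomes B² z (z + 3)
  -- = z − 1, and u = z − 1.
  set z : ℝ := (1 - p) / ((1 + p) * B) with hz
  have hz0 : 0 < z := by positivity
  have hzB : z * B * (1 + p) = 1 - p := by rw [hz]; field_simp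
  have hquad : B ^ 2 * (z * (z + 3)) = z - 1 := by
    rw [hz]; field_simp; linarith
  have hz1 : 1 ≤ z := by nlinarith [show 0 < B ^ 2 * (z * (z + 3)) by positivity]
  have hzlt : z < 1.933 := by
    by_contra! h
    have hb : B ^ 2 ≤ 0.09784384 := by nlinarith
    -- The two roots z of the quadratic have product 1/B², so z B ≤ 1 selects the smaller one.
    have h2 : z * B ≤ 1 := by
      have : z * B ≤ z * B * (1 + p) := le_mul_of_one_le_right (by positivity) (by linarith)
      linarith
    have h3 : B ^ 2 * z ^ 2 ≤ 1 := by nlinarith [show 0 ≤ z * B by positivity]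
    nlinarith [mul_nonneg (sub_nonneg.2 h) (sub_nonneg.2 h3), mul_le_mul_of_nonneg_right hb hz0.le]
  refine ⟨by rw [hlam]; positivity, z - 1, by linarith, by linarith, ?_, ?_⟩
  · have hy : (1 + B - p * (1 - B)) / (1 + B + p * (1 - B)) = B * (z + 3) / 2 := by
      have hBz : B * (z + 3) = (1 - p + 3 * B * (1 + p)) / (1 + p) := by rw [hz]; field_simp
      rw [hBz, div_eq_iff hpB'.ne']
      field_simp
      linear_combination -hp2
    have hx : (1 - p) / (1 + p) = z * B := by rw [hz]; field_simp
    rw [hlam, hy, hx, critL]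
    field_simp
    ring
  · rw [critb, eq_div_iff (by nlinarith)]
    linarith

/-! ### Weights and plus counts under changes of spins. -/

section Graph

variable {V : Type*}

theorem monoEdges_eq [Finite V] (G : SimpleGraph V) (σ : V → Bool) (v : V) :
    monoEdges G σ = {e ∈ G.edgeSet | v ∉ e ∧ (e.map σ).IsDiag}.ncard +
      {u | G.Adj v u ∧ σ u = σ v}.ncard := by
  have himg : {u | G.Adj v u ∧ σ u = σ v}.ncard =
      ((fun u => s(v, u)) '' {u | G.Adj v u ∧ σ u = σ v}).ncard :=
    (Set.ncard_image_of_injective _ fun a b h => Sym2.congr_right.1 h).symm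
  rw [himg, monoEdges, ← Set.ncard_union_eq ?_ (Set.toFinite _) (Set.toFinite _)]
  · congr 1
    ext e
    induction e with
    | _ x y =>
      simp only [Set.mem_ofPred_eq, Set.mem_union, Set.mem_image, SimpleGraph.mem_edgeSet,
        Sym2.mem_iff, Sym2.map_mk, Sym2.mk_isDiag_iff, not_or, Sym2.eq_iff]
      constructor
      · rintro ⟨hxy, h⟩
        by_cases hx : v = x
        · subst hx
          exact Or.inr ⟨y, ⟨hxy, h.symm⟩, Or.inl ⟨rfl, rfl⟩⟩
        by_cases hy : v = y
        · subst hy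
          exact Or.inr ⟨x, ⟨hxy.symm, h⟩, Or.inr ⟨rfl, rfl⟩⟩
        exact Or.inl ⟨hxy, ⟨hx, hy⟩, h⟩
      · rintro (⟨hxy, -, h⟩ | ⟨u, ⟨hu, h⟩, ⟨rfl, rfl⟩ | ⟨rfl, rfl⟩⟩)
        · exact ⟨hxy, h⟩
        · exact ⟨hu, h.symm⟩
        · exact ⟨hu.symm, h⟩
  · rw [Set.disjoint_left]
    rintro _ ⟨-, hv, -⟩ ⟨u, -, rfl⟩
    exact hv (Sym2.mem_mk_left _ _)

/-- The number of neighbours of `v` with spin `+`. -/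
noncomputable def plusNeighbors (G : SimpleGraph V) (σ : V → Bool) (v : V) : ℕ :=
  {u | G.Adj v u ∧ σ u = true}.ncard

/-- The weight of a spin assignment in `isingZ`. -/
noncomputable def spinWeight [Fintype V] (G : SimpleGraph V) (B l : ℝ) (σ : V → Bool) : ℝ :=
  B ^ monoEdges G σ * l ^ numPlus σ

theorem spinWeight_pos [Fintype V] (G : SimpleGraph V) {B l : ℝ} (hB : 0 < B) (hl : 0 < l)
    (σ : V → Bool) : 0 < spinWeight G B l σ := by
  unfold spinWeight; positivity

theorem plusNeighbors_le [Finite V] (G : SimpleGraph V) (σ : V → Bool) (v : V) :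
    plusNeighbors G σ v ≤ {u | G.Adj v u}.ncard :=
  Set.ncard_le_ncard (fun _ h => h.1) (Set.toFinite _)

variable [DecidableEq V]

theorem plusNeighbors_update [Finite V] (G : SimpleGraph V) {σ : V → Bool} {y : V}
    (hy : σ y = false) (s : Bool) (x : V) [Decidable (G.Adj x y)] :
    plusNeighbors G (Function.update σ y s) x =
      plusNeighbors G σ x + (if G.Adj x y then 1 else 0) * s.toNat := by
  cases s
  · rw [← hy, Function.update_eq_self]; simp [hy]
  by_cases hxy : G.Adj x y
  · have : {u | G.Adj x u ∧ Function.update σ y true u = true} =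
        insert y {u | G.Adj x u ∧ σ u = true} := by
      ext u
      by_cases hu : u = y
      · subst hu; simp [hxy]
      · simp [hu]
    rw [plusNeighbors, this, Set.ncard_insert_of_notMem (by simp [hy]), if_pos hxy]
    rfl
  · have : {u | G.Adj x u ∧ Function.update σ y true u = true} =
        {u | G.Adj x u ∧ σ u = true} := by
      ext u
      by_cases hu : u = y
      · subst hu; simp [hxy]
      · simp [hu]
    rw [plusNeighbors, this, if_neg hxy]
    simp [plusNeighbors]

variable [Fintype V]

theorem numPlus_update_true {σ : V → Bool} {y : V} (hy : σ y = false) :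
    numPlus (Function.update σ y true) = numPlus σ + 1 := by
  have : ({v | Function.update σ y true v = true} : Finset V) =
      insert y ({v | σ v = true} : Finset V) := by
    ext u
    by_cases hu : u = y
    · subst hu; simp
    · simp [hu]
  rw [numPlus, numPlus, ← card_insert_of_notMem (a := y) (by simp [hy]), ← this]

/-- Turning y from minus to plus, with j plus neighbours, replaces 3 − j monochromatic edges by j.
The factor is l B^(2j−3) = L b^j with L = l/B³ and b = B². -/
theorem spinWeight_update (G : SimpleGraph V) {B : ℝ} (hB : 0 < B) (l : ℝ) {σ : V → Bool}
    {y : V} (hdeg : {u | G.Adj y u}.ncard = 3) (hy : σ y = false) (s : Bool) :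
    spinWeight G B l (Function.update σ y s) =
      (l / B ^ 3 * (B ^ 2) ^ plusNeighbors G σ y) ^ s.toNat * spinWeight G B l σ := by
  cases s
  · rw [← hy, Function.update_eq_self]; simp [hy]
  have hedge : {e ∈ G.edgeSet | y ∉ e ∧ (e.map (Function.update σ y true)).IsDiag} =
      {e ∈ G.edgeSet | y ∉ e ∧ (e.map σ).IsDiag} := by
    ext e
    induction e with
    | _ a b =>
      simp only [Set.mem_ofPred_eq, Sym2.mem_iff, Sym2.map_mk, Sym2.mk_isDiag_iff, not_or]
      refine and_congr_right fun _ => and_congr_right fun h => ?_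
      rw [Function.update_of_ne (Ne.symm h.1), Function.update_of_ne (Ne.symm h.2)]
  have hplus : {u | G.Adj y u ∧ Function.update σ y true u = Function.update σ y true y} =
      {u | G.Adj y u ∧ σ u = true} := by
    ext u
    by_cases hu : u = y
    · subst hu; simp
    · simp [hu]
  have hcard : {u | G.Adj y u ∧ σ u = true}.ncard + {u | G.Adj y u ∧ σ u = σ y}.ncard = 3 := by
    rw [← hdeg, ← Set.ncard_union_eq ?_ (Set.toFinite _) (Set.toFinite _)]
    · congr 1
      ext u
      cases h : σ u <;> simp [hy, h]
    · rw [Set.disjoint_left]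
      rintro u ⟨-, h⟩ ⟨-, h'⟩
      simp [h, hy] at h'
  rw [spinWeight, spinWeight, monoEdges_eq G _ y, hedge, hplus, monoEdges_eq G σ y,
    numPlus_update_true hy, plusNeighbors]
  generalize {u | G.Adj y u ∧ σ u = true}.ncard = j at hcard ⊢
  generalize {u | G.Adj y u ∧ σ u = σ y}.ncard = i at hcard ⊢
  rw [← hcard, Bool.toNat_true, pow_one]
  field_simp
  ring

theorem sum_update (F : (V → Bool) → ℝ) (y : V) :
    ∑ σ, ∑ s, F (Function.update σ y s) = 2 * ∑ σ, F σ := by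
  have hinv : Function.Involutive fun σ : V → Bool => Function.update σ y (!σ y) := by
    intro σ; simp
  have hflip : ∑ σ, F (Function.update σ y (!σ y)) = ∑ σ, F σ :=
    Equiv.sum_comp hinv.toPerm F
  have (σ : V → Bool) :
      ∑ s, F (Function.update σ y s) = F σ + F (Function.update σ y (!σ y)) := by
    have h := Function.update_eq_self y σ
    rw [Fintype.sum_bool]
    cases hy : σ y <;> rw [hy] at h <;> rw [h]
    · exact add_comm _ _
    · rfl
  rw [sum_congr rfl fun σ _ => this σ, sum_add_distrib, hflip, two_mul]

/-- The spin assignment `σ` with the spins of four vertices replaced. -/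
def updateFour (σ : V → Bool) (v x y z : V) (s₀ s₁ s₂ s₃ : Bool) : V → Bool :=
  Function.update (Function.update (Function.update (Function.update σ z s₃) y s₂) x s₁) v s₀

/-- Resampling four spins stands in for conditioning on the spins outside. -/
theorem sum_updateFour (F : (V → Bool) → ℝ) (v x y z : V) :
    ∑ σ, ∑ s₀, ∑ s₁, ∑ s₂, ∑ s₃, F (updateFour σ v x y z s₀ s₁ s₂ s₃) = 16 * ∑ σ, F σ := by
  have h1 := sum_update F v
  have h2 := sum_update (fun σ => ∑ s₀, F (Function.update σ v s₀)) x
  have h3 := sum_update (fun σ => ∑ s₁, ∑ s₀, F (Function.update (Function.update σ x s₁) v s₀)) y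
  have h4 := sum_update (fun σ => ∑ s₂, ∑ s₁, ∑ s₀,
    F (Function.update (Function.update (Function.update σ y s₂) x s₁) v s₀)) z
  rw [h3, h2, h1] at h4
  rw [show (16 : ℝ) * ∑ σ, F σ = 2 * (2 * (2 * (2 * ∑ σ, F σ))) by ring, ← h4]
  refine sum_congr rfl fun σ _ => ?_
  simp only [Fintype.sum_bool, updateFour]
  ring

/-- The local observable at `v`: its spin minus `a`, plus the discrepancy of `f` between `v` and its
neighbours. -/
noncomputable def observable (G : SimpleGraph V) (a : ℝ) (f : ℕ → ℝ) (x y z v : V)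
    (σ : V → Bool) : ℝ :=
  (σ v).toNat - a + f (plusNeighbors G σ v) -
    (f (plusNeighbors G σ x) + f (plusNeighbors G σ y) + f (plusNeighbors G σ z)) / 3

theorem sum_bool_toNat (F : ℕ → ℝ) : ∑ s : Bool, F s.toNat = ∑ s ∈ range 2, F s := by
  simp [sum_range_succ, add_comm]

open Classical in
theorem sum_updateFour_observable (G : SimpleGraph V) {B : ℝ} (hB : 0 < B) (l a : ℝ)
    (f : ℕ → ℝ) {v x y z : V} (hxy : x ≠ y) (hxz : x ≠ z) (hyz : y ≠ z)
    (hv : ∀ w, G.Adj v w ↔ w = x ∨ w = y ∨ w = z)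
    (hdeg : ∀ w, {u | G.Adj w u}.ncard = 3) (σ : V → Bool) :
    ∃ (ρ : V → Bool) (k₁ k₂ k₃ : ℕ),
      k₁ + (if G.Adj x y then 1 else 0) + (if G.Adj x z then 1 else 0) ≤ 2 ∧
      k₂ + (if G.Adj x y then 1 else 0) + (if G.Adj y z then 1 else 0) ≤ 2 ∧
      k₃ + (if G.Adj x z then 1 else 0) + (if G.Adj y z then 1 else 0) ≤ 2 ∧
      ∑ s₀, ∑ s₁, ∑ s₂, ∑ s₃, spinWeight G B l (updateFour σ v x y z s₀ s₁ s₂ s₃) *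
          observable G a f x y z v (updateFour σ v x y z s₀ s₁ s₂ s₃) =
        spinWeight G B l ρ * localSum a f (l / B ^ 3) (B ^ 2)
          (if G.Adj x y then 1 else 0) (if G.Adj x z then 1 else 0)
          (if G.Adj y z then 1 else 0) k₁ k₂ k₃ := by
  have hvx : G.Adj v x := (hv x).2 (by simp)
  have hvy : G.Adj v y := (hv y).2 (by simp)
  have hvz : G.Adj v z := (hv z).2 (by simp)
  set e₁₂ : ℕ := if G.Adj x y then 1 else 0 with he₁₂
  set e₁₃ : ℕ := if G.Adj x z then 1 else 0 with he₁₃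
  set e₂₃ : ℕ := if G.Adj y z then 1 else 0 with he₂₃
  -- The spins of σ at the four vertices are overwritten anyway, so all of them may start as minus.
  set ρ := updateFour σ v x y z false false false false with hρ
  have hσρ (s₀ s₁ s₂ s₃ : Bool) :
      updateFour σ v x y z s₀ s₁ s₂ s₃ = updateFour ρ v x y z s₀ s₁ s₂ s₃ := by
    ext w
    simp only [hρ, updateFour, Function.update_apply]
    split_ifs <;> rfl
  have hv0 : ρ v = false := by rw [hρ]; simp [updateFour]
  have hx0 : ρ x = false := by rw [hρ]; simp [updateFour, hvx.ne']
  have hy0 : ρ y = false := by rw [hρ]; simp [updateFour, hvy.ne', hxy.symm]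
  have hz0 : ρ z = false := by rw [hρ]; simp [updateFour, hvz.ne', hxz.symm, hyz.symm]
  have hjv : plusNeighbors G ρ v = 0 := by
    rw [plusNeighbors, Set.ncard_eq_zero (Set.toFinite _), Set.eq_empty_iff_forall_notMem]
    rintro w ⟨hw, hw'⟩
    rcases (hv w).1 hw with h | h | h <;> rw [h] at hw' <;> simp [hx0, hy0, hz0] at hw'
  have hupd (s₀ s₁ s₂ s₃ : Bool) (w : V) :
      plusNeighbors G (updateFour ρ v x y z s₀ s₁ s₂ s₃) w =
        plusNeighbors G ρ w + (if G.Adj w z then 1 else 0) * s₃.toNat +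
          (if G.Adj w y then 1 else 0) * s₂.toNat + (if G.Adj w x then 1 else 0) * s₁.toNat +
          (if G.Adj w v then 1 else 0) * s₀.toNat := by
    rw [updateFour, plusNeighbors_update, plusNeighbors_update, plusNeighbors_update,
      plusNeighbors_update] <;>
      simp [hv0, hx0, hy0, hz0, hvx.ne, hvy.ne, hvz.ne, hxy, hxz, hyz]
  have hpv (s₀ s₁ s₂ s₃ : Bool) : plusNeighbors G (updateFour ρ v x y z s₀ s₁ s₂ s₃) v =
      s₁.toNat + s₂.toNat + s₃.toNat := by
    rw [hupd, hjv]
    simp only [hvx, hvy, hvz, G.irrefl, if_true, if_false]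
    ring
  have hpx (s₀ s₁ s₂ s₃ : Bool) : plusNeighbors G (updateFour ρ v x y z s₀ s₁ s₂ s₃) x =
      plusNeighbors G ρ x + s₀.toNat + e₁₂ * s₂.toNat + e₁₃ * s₃.toNat := by
    rw [hupd]
    simp only [hvx.symm, G.irrefl, if_true, if_false, he₁₂, he₁₃]
    ring
  have hpy (s₀ s₁ s₂ s₃ : Bool) : plusNeighbors G (updateFour ρ v x y z s₀ s₁ s₂ s₃) y =
      plusNeighbors G ρ y + s₀.toNat + e₁₂ * s₁.toNat + e₂₃ * s₃.toNat := by
    rw [hupd]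
    simp only [hvy.symm, G.irrefl, if_true, if_false, he₁₂, he₂₃, G.adj_comm y x]
    ring
  have hpz (s₀ s₁ s₂ s₃ : Bool) : plusNeighbors G (updateFour ρ v x y z s₀ s₁ s₂ s₃) z =
      plusNeighbors G ρ z + s₀.toNat + e₁₃ * s₁.toNat + e₂₃ * s₂.toNat := by
    rw [hupd]
    simp only [hvz.symm, G.irrefl, if_true, if_false, he₁₃, he₂₃, G.adj_comm z x, G.adj_comm z y]
    ring
  -- The spins are set in the order z, y, x, v. Each step sees only the plus neighbours already
  -- present, so each plus-plus edge contributes b once.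
  have hw (s₀ s₁ s₂ s₃ : Bool) : spinWeight G B l (updateFour ρ v x y z s₀ s₁ s₂ s₃) =
      (l / B ^ 3 * (B ^ 2) ^ (s₁.toNat + s₂.toNat + s₃.toNat)) ^ s₀.toNat *
        ((l / B ^ 3 * (B ^ 2) ^ (plusNeighbors G ρ x + e₁₃ * s₃.toNat + e₁₂ * s₂.toNat)) ^ s₁.toNat *
          ((l / B ^ 3 * (B ^ 2) ^ (plusNeighbors G ρ y + e₂₃ * s₃.toNat)) ^ s₂.toNat *
            ((l / B ^ 3 * (B ^ 2) ^ plusNeighbors G ρ z) ^ s₃.toNat * spinWeight G B l ρ))) := by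
    have hv' : plusNeighbors G
        (Function.update (Function.update (Function.update ρ z s₃) y s₂) x s₁) v =
        s₁.toNat + s₂.toNat + s₃.toNat := by
      have := hpv false s₁ s₂ s₃
      rwa [updateFour, Function.update_eq_self_iff.2] at this
      simp [hv0, hvx.ne, hvy.ne, hvz.ne]
    rw [updateFour, spinWeight_update G hB l (hdeg v), hv', spinWeight_update G hB l (hdeg x),
      spinWeight_update G hB l (hdeg y), spinWeight_update G hB l (hdeg z),
      plusNeighbors_update, plusNeighbors_update, plusNeighbors_update] <;>
      simp [hv0, hx0, hy0, hz0, hvx.ne, hvy.ne, hvz.ne, hxy, hxz, hyz]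
  have hbound (w : V) : plusNeighbors G (updateFour ρ v x y z true true true true) w ≤ 3 :=
    (plusNeighbors_le G _ w).trans (hdeg w).le
  refine ⟨ρ, plusNeighbors G ρ x, plusNeighbors G ρ y, plusNeighbors G ρ z, ?_, ?_, ?_, ?_⟩
  · have := hbound x
    rw [hpx] at this
    simp only [Bool.toNat_true] at this
    lia
  · have := hbound y
    rw [hpy] at this
    simp only [Bool.toNat_true] at this
    lia
  · have := hbound z
    rw [hpz] at this
    simp only [Bool.toNat_true] at this
    lia
  · simp only [hσρ, localSum, mul_sum, ← sum_bool_toNat]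
    refine sum_congr rfl fun s₀ _ => sum_congr rfl fun s₁ _ => sum_congr rfl fun s₂ _ =>
      sum_congr rfl fun s₃ _ => ?_
    have hs : updateFour ρ v x y z s₀ s₁ s₂ s₃ v = s₀ := by simp [updateFour]
    rw [observable, hpv, hpx, hpy, hpz, hw, hs]
    ring

end Graph

theorem exists_three_neighbors {V : Type*} (G : SimpleGraph V) {v : V}
    (h : {u | G.Adj v u}.ncard = 3) :
    ∃ x y z, x ≠ y ∧ x ≠ z ∧ y ≠ z ∧ ∀ w, G.Adj v w ↔ w = x ∨ w = y ∨ w = z := by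
  obtain ⟨x, y, z, hxy, hxz, hyz, h⟩ := Set.ncard_eq_three.1 h
  exact ⟨x, y, z, hxy, hxz, hyz, fun w => by simpa using Set.ext_iff.1 h w⟩

/-! ### Averaging over vertices. -/

section Occupancy

variable {V : Type*} [Fintype V] (G : SimpleGraph V)

theorem occupancyFraction_eq [DecidableEq V] {B l : ℝ} (hB : 0 < B) (hl : 0 < l) :
    occupancyFraction G B l =
      (∑ σ, spinWeight G B l σ * numPlus σ) / (Fintype.card V * ∑ σ, spinWeight G B l σ) := by
  have hZ (t : ℝ) : isingZ G B t = ∑ σ, spinWeight G B t σ := by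
    unfold isingZ spinWeight
    congr!
  have hpos : 0 < ∑ σ, spinWeight G B l σ :=
    sum_pos (fun σ _ => spinWeight_pos G hB hl σ) univ_nonempty
  have hderiv : HasDerivAt (fun t => ∑ σ, spinWeight G B t σ)
      (∑ σ, B ^ monoEdges G σ * (numPlus σ * l ^ (numPlus σ - 1))) l :=
    HasDerivAt.fun_sum fun σ _ => (hasDerivAt_pow _ _).const_mul _
  have hnum : ∑ σ, spinWeight G B l σ * numPlus σ =
      l * ∑ σ, B ^ monoEdges G σ * (numPlus σ * l ^ (numPlus σ - 1)) := by
    rw [mul_sum]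
    refine sum_congr rfl fun σ _ => ?_
    unfold spinWeight
    rcases h : numPlus σ with _ | m
    · simp
    · rw [Nat.add_sub_cancel, pow_succ]; ring
  simp only [occupancyFraction, hZ]
  rw [(hderiv.log hpos.ne').deriv, hnum]
  field_simp

theorem numPlus_eq_sum (σ : V → Bool) : numPlus σ = ∑ v, (σ v).toNat := by
  rw [numPlus, card_filter]
  refine sum_congr rfl fun v _ => ?_
  cases σ v <;> rfl

variable {G}

/-- Double counting: each vertex is a neighbour of exactly three vertices. -/
theorem sum_neighbors {x y z : V → V} (hxy : ∀ v, x v ≠ y v)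
    (hxz : ∀ v, x v ≠ z v) (hyz : ∀ v, y v ≠ z v)
    (hv : ∀ v w, G.Adj v w ↔ w = x v ∨ w = y v ∨ w = z v)
    (hdeg : ∀ v, {u | G.Adj v u}.ncard = 3) (F : V → ℝ) :
    ∑ v, (F (x v) + F (y v) + F (z v)) = 3 * ∑ v, F v := by
  classical
  have h1 (v : V) : F (x v) + F (y v) + F (z v) = ∑ u, if G.Adj v u then F u else 0 := by
    have : ({u | G.Adj v u} : Finset V) = {x v, y v, z v} := by ext w; simp [hv]
    rw [← sum_filter, this, sum_insert (by simp [hxy, hxz]), sum_pair (hyz v), add_assoc]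
  have h2 (u : V) : (∑ v, if G.Adj v u then F u else 0) = 3 * F u := by
    have := hdeg u
    rw [Set.ncard_eq_toFinset_card', Set.toFinset_ofPred] at this
    simp_rw [G.adj_comm _ u]
    rw [← sum_filter, sum_const, this, nsmul_eq_mul]
    norm_num
  rw [sum_congr rfl fun v _ => h1 v, sum_comm, mul_sum]
  exact sum_congr rfl fun u _ => h2 u

theorem sum_observable [DecidableEq V] {x y z : V → V} (hxy : ∀ v, x v ≠ y v)
    (hxz : ∀ v, x v ≠ z v) (hyz : ∀ v, y v ≠ z v)
    (hv : ∀ v w, G.Adj v w ↔ w = x v ∨ w = y v ∨ w = z v)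
    (hdeg : ∀ v, {u | G.Adj v u}.ncard = 3) (a : ℝ) (f : ℕ → ℝ) (σ : V → Bool) :
    ∑ v, observable G a f (x v) (y v) (z v) v σ = numPlus σ - Fintype.card V * a := by
  have h := sum_neighbors hxy hxz hyz hv hdeg fun v => f (plusNeighbors G σ v)
  simp only [observable, sum_sub_distrib, sum_add_distrib, ← sum_div] at h ⊢
  rw [h, numPlus_eq_sum]
  simp

theorem occupancyFraction_sub_mul [DecidableEq V] [Nonempty V] {x y z : V → V}
    (hxy : ∀ v, x v ≠ y v) (hxz : ∀ v, x v ≠ z v) (hyz : ∀ v, y v ≠ z v)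
    (hv : ∀ v w, G.Adj v w ↔ w = x v ∨ w = y v ∨ w = z v)
    (hdeg : ∀ v, {u | G.Adj v u}.ncard = 3) {B l : ℝ} (hB : 0 < B) (hl : 0 < l) (a : ℝ)
    (f : ℕ → ℝ) :
    (occupancyFraction G B l - a) * (16 * (Fintype.card V * ∑ σ, spinWeight G B l σ)) =
      ∑ v, ∑ σ, ∑ s₀, ∑ s₁, ∑ s₂, ∑ s₃,
        spinWeight G B l (updateFour σ v (x v) (y v) (z v) s₀ s₁ s₂ s₃) *
          observable G a f (x v) (y v) (z v) v
            (updateFour σ v (x v) (y v) (z v) s₀ s₁ s₂ s₃) := by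
  have hpos : 0 < ∑ σ, spinWeight G B l σ :=
    sum_pos (fun σ _ => spinWeight_pos G hB hl σ) univ_nonempty
  have hcard : (0 : ℝ) < Fintype.card V := by exact_mod_cast Fintype.card_pos
  have h (v : V) := sum_updateFour
    (fun σ => spinWeight G B l σ * observable G a f (x v) (y v) (z v) v σ) v (x v) (y v) (z v)
  rw [sum_congr rfl fun v _ => h v, ← mul_sum, sum_comm]
  simp_rw [← mul_sum, sum_observable hxy hxz hyz hv hdeg, mul_sub, sum_sub_distrib, ← sum_mul]
  rw [occupancyFraction_eq G hB hl]
  field_simp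

/-- If the local sums of a cubic graph are nonnegative, then `a` is a lower bound for its occupancy
fraction. -/
theorem le_occupancyFraction [Nonempty V] (hdeg : ∀ v, {u | G.Adj v u}.ncard = 3) {B l : ℝ}
    (hB : 0 < B) (hl : 0 < l) (a : ℝ) (f : ℕ → ℝ)
    (h : ∀ e₁₂ e₁₃ e₂₃ k₁ k₂ k₃ : ℕ, e₁₂ ≤ 1 → e₁₃ ≤ 1 → e₂₃ ≤ 1 → k₁ + e₁₂ + e₁₃ ≤ 2 →
      k₂ + e₁₂ + e₂₃ ≤ 2 → k₃ + e₁₃ + e₂₃ ≤ 2 →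
      0 ≤ localSum a f (l / B ^ 3) (B ^ 2) e₁₂ e₁₃ e₂₃ k₁ k₂ k₃) :
    a ≤ occupancyFraction G B l := by
  classical
  choose x y z hxy hxz hyz hv using fun v => exists_three_neighbors G (hdeg v)
  have key := occupancyFraction_sub_mul hxy hxz hyz hv hdeg hB hl a f
  have hpos : 0 < ∑ σ, spinWeight G B l σ :=
    sum_pos (fun σ _ => spinWeight_pos G hB hl σ) univ_nonempty
  have hcard : (0 : ℝ) < Fintype.card V := by exact_mod_cast Fintype.card_pos
  rw [← sub_nonneg]
  refine nonneg_of_mul_nonneg_left (key ▸ sum_nonneg fun v _ => sum_nonneg fun σ _ => ?_)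
    (by positivity)
  obtain ⟨ρ, k₁, k₂, k₃, h₁, h₂, h₃, hsum⟩ :=
    sum_updateFour_observable G hB l a f (hxy v) (hxz v) (hyz v) (hv v) hdeg σ
  rw [hsum]
  refine mul_nonneg (spinWeight_pos G hB hl ρ).le (h _ _ _ _ _ _ ?_ ?_ ?_ h₁ h₂ h₃) <;>
    split_ifs <;> simp

end Occupancy

/-! ### The complete graph and the conclusion. -/

theorem occupancyFraction_top {B l : ℝ} (hB : 0 < B) (hl : 0 < l) :
    occupancyFraction (⊤ : SimpleGraph (Fin 4)) B l = occK4 (l / B ^ 3) (B ^ 2) := by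
  have hdeg (v : Fin 4) : {u | (⊤ : SimpleGraph (Fin 4)).Adj v u}.ncard = 3 := by
    rw [Set.ncard_eq_toFinset_card']
    revert v
    decide
  choose x y z hxy hxz hyz hv using fun v => exists_three_neighbors _ (hdeg v)
  -- With f = 0 the averaging identity computes the occupancy of K₄: every neighbourhood is a
  -- triangle, so all local sums vanish.
  have key := occupancyFraction_sub_mul hxy hxz hyz hv hdeg hB hl (occK4 (l / B ^ 3) (B ^ 2))
    fun _ => 0
  have hpos : 0 < ∑ σ, spinWeight (⊤ : SimpleGraph (Fin 4)) B l σ :=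
    sum_pos (fun σ _ => spinWeight_pos _ hB hl σ) univ_nonempty
  rw [sum_eq_zero fun v _ => sum_eq_zero fun σ _ => ?_, mul_eq_zero] at key
  · refine sub_eq_zero.1 (key.resolve_right ?_)
    simp [hpos.ne']
  obtain ⟨ρ, k₁, k₂, k₃, h₁, h₂, h₃, hsum⟩ := sum_updateFour_observable ⊤ hB l
    (occK4 (l / B ^ 3) (B ^ 2)) (fun _ => 0) (hxy v) (hxz v) (hyz v) (hv v) hdeg σ
  simp only [SimpleGraph.top_adj, ne_eq, hxy, hxz, hyz, not_false_eq_true, if_true] at h₁ h₂ h₃ hsum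
  obtain ⟨rfl, rfl, rfl⟩ : k₁ = 0 ∧ k₂ = 0 ∧ k₃ = 0 := by lia
  rw [hsum, localSum_triangle _ (by positivity) (by positivity), mul_zero]

theorem ncard_adj_of_isRegularOfDegree {V : Type*} {G : SimpleGraph V} [G.LocallyFinite] {d : ℕ}
    (h : G.IsRegularOfDegree d) (v : V) : {u | G.Adj v u}.ncard = d := by
  rw [← h v, ← SimpleGraph.card_neighborSet_eq_degree, ← Nat.card_eq_fintype_card]
  rfl

theorem occupancyFraction_top_le {B : ℝ} (hB0 : 0 ≤ B) (hB1 : B ≤ 0.3128) {V : Type*} [Fintype V]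
    [Nonempty V] {G : SimpleGraph V} (hdeg : ∀ v, {u | G.Adj v u}.ncard = 3) :
    occupancyFraction (⊤ : SimpleGraph (Fin 4)) B (lambdaC 3 B) ≤
      occupancyFraction G B (lambdaC 3 B) := by
  rcases hB0.eq_or_lt with rfl | hB
  · have : lambdaC 3 0 = 0 := by norm_num [lambdaC, criticalB]
    simp [occupancyFraction, this]
  obtain ⟨hl, u, hu, hU, hL, hb⟩ := exists_critical_parameter hB hB1
  rw [occupancyFraction_top hB hl]
  refine le_occupancyFraction hdeg hB hl _ (mult u) fun _ _ _ _ _ _ h₁₂ h₁₃ h₂₃ h₁ h₂ h₃ => ?_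
  rw [hL, hb]
  exact localSum_nonneg hu hU h₁₂ h₁₃ h₂₃ h₁ h₂ h₃

theorem theorem1p2 (B : ℝ) (hB0 : 0 ≤ B) (hB1 : B ≤ 0.3128) :
    (⊤ : SimpleGraph (Fin 4)).IsRegularOfDegree 3 ∧
    (∀ (V : Type*) [Fintype V] [Nonempty V] (G : SimpleGraph V) [DecidableRel G.Adj],
      G.IsRegularOfDegree 3 →
        occupancyFraction (⊤ : SimpleGraph (Fin 4)) B (lambdaC 3 B) ≤
          occupancyFraction G B (lambdaC 3 B)) ∧
    alphaC 3 B = occupancyFraction (⊤ : SimpleGraph (Fin 4)) B (lambdaC 3 B) := by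
  have htop : (⊤ : SimpleGraph (Fin 4)).IsRegularOfDegree 3 :=
    fun v => by revert v; decide
  refine ⟨htop, fun V _ _ G _ hG =>
    occupancyFraction_top_le hB0 hB1 (ncard_adj_of_isRegularOfDegree hG), ?_⟩
  refine IsLeast.csInf_eq ⟨⟨4, ⊤, by norm_num, by convert htop, rfl⟩, ?_⟩
  rintro _ ⟨n, G, hn, hG, rfl⟩
  have : Nonempty (Fin n) := ⟨⟨0, hn⟩⟩
  exact occupancyFraction_top_le hB0 hB1 (by classical exact ncard_adj_of_isRegularOfDegree hG)
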